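/- For positive integers $a,b$ with $a+b\ge 3$ let $$\bar T(a,b)=4\sum_{0<n_1<n_2}\frac{(-1)^{n_2}}{(2n_1-1)^{a}(2n_2-2)^{b}}:=\lim_{N\to\infty}4\sum_{n_2=1}^{N}\ \sum_{1\le n_1<n_2}\frac{(-1)^{n_2}}{(2n_1-1)^{a}(2n_2-2)^{b}},$$ and for an integer $w\ge 3$ let $W(w,2)=\sum_{a+b=w,\ a,b\ge 1}\bar T(a,b)$. Let $\bar\zeta(0)=\tfrac12$ and $\bar\zeta(s)=\sum_{n\ge 1}(-1)^{n-1}n^{-s}$ for integers $s\ge 1$. Let $\tilde t(1)=0$ and $\tilde t(n)=2^n\sum_{m\ge 0}(2m+1)^{-n}$ for integers $n>1$. **Theorem 3.4.** Let $k$ be a positive integer. For all positive integers $a,b$ with $a+b=2k+1$ the limit defining $\bar T(a,b)$ exists, and $$W(2k+1,2)=\frac{1}{2^{2k-1}}\sum_{j=1}^{k}\tilde t(2j+1)\,\bar\zeta(2k-2j),$$ where $\tilde t(n)=(2^n-1)\zeta(n)$ for every integer $n>1$. Consequently $W(2k+1,2)$ reduces to zeta values: $$W(2k+1,2)=\frac{1}{2^{2k-1}}\Bigl(\tfrac12(2^{2k+1}-1)\zeta(2k+1)+\sum_{j=1}^{k-1}(2^{2j+1}-1)(1-2^{1-2k+2j})\,\zeta(2j+1)\,\zeta(2k-2j)\Bigr).$$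 -/

import Mathlib

open Filter Topology

/-- Truncation `n₂ ≤ N` of the alternating double `T`-series
`2² ∑_{0 < n₁ < n₂} (-1)^{n₂} / ((2 n₁ - 1)^a (2 n₂ - 2)^b)`. -/
noncomputable def altDoubleTPartial (a b N : ℕ) : ℝ :=
  2 ^ 2 * ∑ n₂ ∈ Finset.Icc 1 N, ∑ n₁ ∈ Finset.Ico 1 n₂,
    (-1 : ℝ) ^ n₂ / ((2 * (n₁ : ℝ) - 1) ^ a * (2 * (n₂ : ℝ) - 2) ^ b)

/-- The alternating double `T`-value with index `(a, b)` and the sign on the largest summation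
variable: the limit of the truncated sums. For `b = 1` the series is only conditionally
convergent, so it is summed in the order of the largest variable. -/
noncomputable def altDoubleT (a b : ℕ) : ℝ :=
  limUnder atTop (altDoubleTPartial a b)

/-- The indices `(a, b)` of positive integers of weight `a + b = w` and depth `2`. -/
def indices2 (w : ℕ) : Finset (ℕ × ℕ) :=
  (Finset.HasAntidiagonal.antidiagonal w).filter fun p => 1 ≤ p.1 ∧ 1 ≤ p.2

/-- The depth two sum `W(w, 2)`. The binomial weights of the general weighted sum
`W_m(w, 2)` are all `1` for `m = 1`. -/
noncomputable def W2 (w : ℕ) : ℝ := ∑ p ∈ indices2 w, altDoubleT p.1 p.2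

/-- The alternating zeta value `∑_{n ≥ 1} (-1)^{n-1} / n^s`, as a limit of partial sums,
with the convention that its value at `0` is `1/2`. -/
noncomputable def altZeta (s : ℕ) : ℝ :=
  if s = 0 then 1 / 2
  else limUnder atTop fun N : ℕ =>
    ∑ n ∈ Finset.Icc 1 N, (-1 : ℝ) ^ (n - 1) / (n : ℝ) ^ s

/-- The depth one `t`-value: the sum of `1 / m^s` over odd positive `m`. -/
noncomputable def tValue (s : ℕ) : ℝ := ∑' n : ℕ, 1 / (2 * (n : ℝ) + 1) ^ s

/-- The normalised `t`-value `2^s t(s)` for `s > 1`, set to `0` otherwise. -/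
noncomputable def tTilde (s : ℕ) : ℝ := if 1 < s then 2 ^ s * tValue s else 0

/-!
For odd `x` and even `y`, the geometric sum over `a + b = w` turns `∑ 1 / (x ^ a * y ^ b)` into
`(x ^ (1 - w) - y ^ (1 - w)) / (y - x)`. In the sum over `x < y` the difference `y - x` is again an
odd positive integer, so the first part is the Cauchy product of the series of `β (w - 1)` with
Leibniz' series for `π / 4`, and the second part is an alternating Euler sum.

For `w = 2 k + 1` both are found among the absolutely convergent double series of
`± 1 / (x ^ (s + 1) * y ^ r * (y ^ 2 - x ^ 2))`. Splitting `1 / (y ^ 2 - x ^ 2)` into partial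
fractions, summation over `x` gives the Euler sum when `s = 0`, while summation over `y` gives
`π / 4 * β (s + 2) - t (s + 3) / 2` when `r = 0`. Moving `2` from `s` to `r` changes the double
series by a product of a `t`-value and an alternating zeta value, so that the two ends differ by
the sum of these products; the term `t (2 k + 1) / 2` is the product for `j = k`, where the
alternating zeta value at `0` is `1 / 2`.
-/

section PartialSums

lemma tendsto_sum_range_shift_iff {G : Type*} [AddCommGroup G] [TopologicalSpace G]
    [IsTopologicalAddGroup G] {f : ℕ → G} {L : G} (p : ℕ) :
    Tendsto (fun N => ∑ n ∈ Finset.range N, f (n + p)) atTop (𝓝 L) ↔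
      Tendsto (fun N => ∑ n ∈ Finset.range N, f n) atTop
        (𝓝 (∑ i ∈ Finset.range p, f i + L)) := by
  rw [← tendsto_add_atTop_iff_nat (f := fun N => ∑ n ∈ Finset.range N, f n) p]
  simp_rw [add_comm _ p, Finset.sum_range_add]
  exact (tendsto_const_add_iff _).symm

lemma tendsto_sum_range_sub_shift {G : Type*} [AddCommGroup G] [TopologicalSpace G]
    [IsTopologicalAddGroup G] {f : ℕ → G} (hf : Tendsto f atTop (𝓝 0)) (p : ℕ) :
    Tendsto (fun N => ∑ n ∈ Finset.range N, (f n - f (n + p))) atTop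
      (𝓝 (∑ i ∈ Finset.range p, f i)) := by
  have htelescope (N : ℕ) : ∑ n ∈ Finset.range N, (f n - f (n + p)) =
      ∑ i ∈ Finset.range p, f i - ∑ i ∈ Finset.range p, f (N + i) := by
    rw [Finset.sum_sub_distrib, sub_eq_sub_iff_add_eq_add, ← Finset.sum_range_add, add_comm N p,
      Finset.sum_range_add]
    simp_rw [add_comm p]
  have htail : Tendsto (fun N => ∑ i ∈ Finset.range p, f (N + i)) atTop (𝓝 0) := by
    simpa using tendsto_finsetSum (Finset.range p)
      fun i _ => (tendsto_add_atTop_iff_nat i).mpr hf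
  simp_rw [htelescope]
  simpa using htail.const_sub (∑ i ∈ Finset.range p, f i)

/-- Mertens' theorem on Cauchy products, in terms of partial sums. -/
lemma tendsto_sum_range_cauchyProduct {R : Type*} [NormedRing R] [CompleteSpace R]
    {p q : ℕ → R} {B : R} (hp : Summable fun j => ‖p j‖)
    (hq : Tendsto (fun n => ∑ i ∈ Finset.range n, q i) atTop (𝓝 B)) :
    Tendsto (fun M => ∑ m ∈ Finset.range M, ∑ j ∈ Finset.range (m + 1), p j * q (m - j)) atTop
      (𝓝 ((∑' j, p j) * B)) := by
  obtain ⟨C, hC⟩ := (Metric.isBounded_range_of_tendsto _ hq).exists_norm_le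
  have hlim := tendsto_tsum_of_dominated_convergence (𝓕 := atTop)
    (f := fun M j => p j * ∑ i ∈ Finset.range (M - j), q i) (g := fun j => p j * B)
    (bound := fun j => ‖p j‖ * C) (hp.mul_right C)
    (fun j => (hq.comp (tendsto_sub_atTop_nat j)).const_mul _)
    (Eventually.of_forall fun M j => (norm_mul_le _ _).trans <|
      mul_le_mul_of_nonneg_left (hC _ ⟨M - j, rfl⟩) (norm_nonneg _))
  rw [hp.of_norm.tsum_mul_right] at hlim
  refine hlim.congr fun M => ?_
  rw [Finset.sum_range_diag_flip M fun j i => p j * q i, tsum_eq_sum (s := Finset.range M)]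
  · simp_rw [← Finset.mul_sum]
  · intro j hj
    simp [Nat.sub_eq_zero_of_le (Finset.mem_range.not.mp hj |> not_lt.mp)]

lemma antitone_average {𝕜 : Type*} [Field 𝕜] [LinearOrder 𝕜] [IsStrictOrderedRing 𝕜]
    {u : ℕ → 𝕜} (hu : Antitone u) :
    Antitone fun m : ℕ => ((m + 1 : ℕ) : 𝕜)⁻¹ * ∑ j ∈ Finset.range (m + 1), u j := by
  refine antitone_nat_of_succ_le fun m => ?_
  have hlast : ((m : 𝕜) + 1) * u (m + 1) ≤ ∑ j ∈ Finset.range (m + 1), u j := by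
    simpa using Finset.card_nsmul_le_sum (Finset.range (m + 1)) u (u (m + 1))
      fun j hj => hu (Finset.mem_range.mp hj).le
  rw [Finset.sum_range_succ u (m + 1), inv_mul_eq_div, inv_mul_eq_div,
    div_le_div_iff₀ (by positivity) (by positivity)]
  push_cast
  linarith

lemma tendsto_const_div_two_mul_add (c d : ℝ) :
    Tendsto (fun N : ℕ => c / (2 * (N : ℝ) + d)) atTop (𝓝 0) :=
  tendsto_const_nhds.div_atTop <| tendsto_atTop_add_const_right _ _ <|
    tendsto_natCast_atTop_atTop.const_mul_atTop two_pos

end PartialSums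

section OddEven

lemma even_sub_odd_ne_zero (m n : ℕ) : (2 * (m : ℝ) + 2) - (2 * (n : ℝ) + 1) ≠ 0 := by
  have h : 2 * (m : ℤ) + 2 - (2 * n + 1) ≠ 0 := by omega
  exact_mod_cast h

lemma summable_one_div_odd_pow {s : ℕ} (hs : 1 < s) :
    Summable fun n : ℕ => 1 / (2 * (n : ℝ) + 1) ^ s := by
  have := (Real.summable_one_div_nat_pow.mpr hs).comp_injective
    (i := fun n : ℕ => 2 * n + 1) fun a b h => by simpa using h
  simpa [Function.comp_def] using this

lemma summable_one_div_even_pow {s : ℕ} (hs : 1 < s) :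
    Summable fun m : ℕ => 1 / (2 * (m : ℝ) + 2) ^ s := by
  have := (Real.summable_one_div_nat_pow.mpr hs).comp_injective
    (i := fun m : ℕ => 2 * m + 2) fun a b h => by simpa using h
  simpa [Function.comp_def] using this

lemma norm_neg_one_pow_div_pow {x : ℝ} (hx : 0 ≤ x) (m s : ℕ) :
    ‖(-1 : ℝ) ^ m / x ^ s‖ = 1 / x ^ s := by
  rw [norm_div, norm_pow, norm_neg, norm_one, one_pow, Real.norm_of_nonneg (by positivity)]

/-- The generalised odd harmonic number `O_m^{(a)}`: the sum of `1 / x ^ a` over the first `m` odd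
positive integers `x`. -/
noncomputable def oddHarmonic (a m : ℕ) : ℝ := ∑ j ∈ Finset.range m, 1 / (2 * (j : ℝ) + 1) ^ a

/-- Dirichlet's beta value `β(s) = ∑ (-1)^n / (2 n + 1)^s`, meaningful for `s > 1`, where the
series converges absolutely. -/
noncomputable def dirichletBeta (s : ℕ) : ℝ := ∑' n : ℕ, (-1 : ℝ) ^ n / (2 * (n : ℝ) + 1) ^ s

lemma summable_norm_alternating_odd {s : ℕ} (hs : 1 < s) :
    Summable fun n : ℕ => ‖(-1 : ℝ) ^ n / (2 * (n : ℝ) + 1) ^ s‖ :=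
  (summable_one_div_odd_pow hs).congr fun n =>
    (norm_neg_one_pow_div_pow (by positivity) n s).symm

lemma summable_norm_alternating_even {s : ℕ} (hs : 1 < s) :
    Summable fun m : ℕ => ‖(-1 : ℝ) ^ m / (2 * (m : ℝ) + 2) ^ s‖ :=
  (summable_one_div_even_pow hs).congr fun m =>
    (norm_neg_one_pow_div_pow (by positivity) m s).symm

end OddEven

section AltZeta

lemma hasSum_altZeta {s : ℕ} (hs : 1 < s) :
    HasSum (fun m : ℕ => (-1 : ℝ) ^ m / ((m : ℝ) + 1) ^ s) (altZeta s) := by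
  have hsum : Summable fun m : ℕ => (-1 : ℝ) ^ m / ((m : ℝ) + 1) ^ s := by
    refine ((summable_norm_alternating_even hs).of_norm.mul_left (2 ^ s)).congr fun m => ?_
    rw [show 2 * (m : ℝ) + 2 = 2 * (m + 1) by ring, mul_pow]
    field_simp
  have hlim : altZeta s = ∑' m : ℕ, (-1 : ℝ) ^ m / ((m : ℝ) + 1) ^ s := by
    rw [altZeta, if_neg (by omega)]
    refine Tendsto.limUnder_eq (hsum.hasSum.tendsto_sum_nat.congr fun N => ?_)
    rw [← Finset.Ico_succ_right_eq_Icc, Finset.sum_Ico_eq_sum_range]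
    simp [add_comm]
  exact hlim ▸ hsum.hasSum

lemma tsum_alternating_even {s : ℕ} (hs : 1 < s) :
    ∑' m : ℕ, (-1 : ℝ) ^ m / (2 * (m : ℝ) + 2) ^ s = altZeta s / 2 ^ s := by
  rw [← (hasSum_altZeta hs).tsum_eq, ← tsum_div_const]
  refine tsum_congr fun m => ?_
  rw [show 2 * (m : ℝ) + 2 = (m + 1) * 2 by ring, mul_pow, div_div]

end AltZeta

section AltKernel

/-- The common source of all the single series of the proof, as a double series over odd
`x = 2 n + 1` and even `y = 2 m + 2`, where `p = (n, m)`. The exponent of `x` is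
`s + 1` rather than `s` so that the double series converges absolutely for all `s` and `r`. -/
noncomputable def altKernel (s r : ℕ) (p : ℕ × ℕ) : ℝ :=
  (-1) ^ p.2 / ((2 * (p.1 : ℝ) + 1) ^ (s + 1) * (2 * (p.2 : ℝ) + 2) ^ r *
    ((2 * (p.2 : ℝ) + 2) ^ 2 - (2 * (p.1 : ℝ) + 1) ^ 2))

/-- The sum of `altKernel s r` over all odd `x` and even `y`. -/
noncomputable def altKernelSum (s r : ℕ) : ℝ := ∑' p, altKernel s r p

lemma one_div_mul_abs_sq_sub_sq_le {x y : ℝ} (hx : 0 < x) (hy : 0 < y) (hxy : y - x ≠ 0) :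
    1 / (x * |y ^ 2 - x ^ 2|) ≤ x ^ (-(3 / 2) : ℝ) * |y - x| ^ (-(3 / 2) : ℝ) := by
  have hd : 0 < |y - x| := abs_pos.mpr hxy
  have hmean : (x * |y - x|) ^ (1 / 2 : ℝ) ≤ y + x := by
    have hd_le : |y - x| ≤ y + x := abs_le.mpr ⟨by linarith, by linarith⟩
    rw [← Real.sqrt_eq_rpow]
    exact Real.sqrt_le_iff.mpr ⟨by positivity, by nlinarith⟩
  rw [← Real.mul_rpow hx.le hd.le, Real.rpow_neg (by positivity), ← one_div]
  refine one_div_le_one_div_of_le (by positivity) ?_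
  calc (x * |y - x|) ^ (3 / 2 : ℝ) = x * |y - x| * (x * |y - x|) ^ (1 / 2 : ℝ) := by
        rw [← Real.rpow_one_add' (by positivity) (by norm_num)]; norm_num
    _ ≤ x * |y - x| * (y + x) := by gcongr
    _ = x * |y ^ 2 - x ^ 2| := by
        rw [sq_sub_sq, abs_mul, abs_of_pos (add_pos hy hx)]; ring

lemma summable_one_div_odd_mul_abs_sq_sub_sq :
    Summable fun p : ℕ × ℕ => 1 / ((2 * (p.1 : ℝ) + 1) *
      |(2 * (p.2 : ℝ) + 2) ^ 2 - (2 * (p.1 : ℝ) + 1) ^ 2|) := by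
  have hpow := Real.summable_abs_int_rpow (b := 3 / 2) (by norm_num)
  have hinj : Function.Injective
      fun p : ℕ × ℕ => ((2 * p.1 + 1 : ℤ), (2 * p.2 + 2 - (2 * p.1 + 1) : ℤ)) := by
    rintro ⟨a, b⟩ ⟨c, d⟩ h
    simp only [Prod.mk.injEq] at h ⊢
    omega
  refine .of_nonneg_of_le (fun p => by positivity) (fun p => ?_)
    ((hpow.mul_of_nonneg hpow (fun _ => by positivity) fun _ => by positivity).comp_injective hinj)
  have hbound := one_div_mul_abs_sq_sub_sq_le (x := 2 * (p.1 : ℝ) + 1) (y := 2 * (p.2 : ℝ) + 2)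
    (by positivity) (by positivity) (even_sub_odd_ne_zero p.2 p.1)
  have hodd : |2 * (p.1 : ℝ) + 1| = 2 * (p.1 : ℝ) + 1 := abs_of_pos (by positivity)
  simpa [hodd] using hbound

lemma summable_altKernel (s r : ℕ) : Summable (altKernel s r) := by
  refine .of_norm_bounded summable_one_div_odd_mul_abs_sq_sub_sq fun p => ?_
  have hx : 1 ≤ (2 * (p.1 : ℝ) + 1) ^ s := one_le_pow₀ (by linarith [p.1.cast_nonneg (α := ℝ)])
  have hy : 1 ≤ (2 * (p.2 : ℝ) + 2) ^ r := one_le_pow₀ (by linarith [p.2.cast_nonneg (α := ℝ)])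
  have hd : 0 < |(2 * (p.2 : ℝ) + 2) ^ 2 - (2 * (p.1 : ℝ) + 1) ^ 2| := by
    rw [abs_pos, sq_sub_sq]
    exact mul_ne_zero (by positivity) (even_sub_odd_ne_zero _ _)
  rw [altKernel, norm_div, norm_pow, norm_neg, norm_one, one_pow, norm_mul,
    Real.norm_of_nonneg (by positivity), Real.norm_eq_abs]
  refine one_div_le_one_div_of_le (by positivity) ?_
  gcongr
  calc 2 * (p.1 : ℝ) + 1 = (2 * (p.1 : ℝ) + 1) * 1 * 1 := by ring
    _ ≤ (2 * (p.1 : ℝ) + 1) * (2 * (p.1 : ℝ) + 1) ^ s * (2 * (p.2 : ℝ) + 2) ^ r := by gcongr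
    _ = _ := by ring

lemma altKernel_sub_altKernel (s r : ℕ) (p : ℕ × ℕ) :
    altKernel (s + 2) r p - altKernel s (r + 2) p =
      1 / (2 * (p.1 : ℝ) + 1) ^ (s + 3) * ((-1) ^ p.2 / (2 * (p.2 : ℝ) + 2) ^ (r + 2)) := by
  have hd : (2 * (p.2 : ℝ) + 2) ^ 2 - (2 * (p.1 : ℝ) + 1) ^ 2 ≠ 0 := by
    rw [sq_sub_sq]
    exact mul_ne_zero (by positivity) (even_sub_odd_ne_zero _ _)
  have hx : 2 * (p.1 : ℝ) + 1 ≠ 0 := by positivity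
  have hy : 2 * (p.2 : ℝ) + 2 ≠ 0 := by positivity
  unfold altKernel
  generalize 2 * (p.1 : ℝ) + 1 = x at *
  generalize 2 * (p.2 : ℝ) + 2 = y at *
  field_simp
  ring

lemma tValue_mul_altZeta (s r : ℕ) :
    tValue (s + 3) * (altZeta (r + 2) / 2 ^ (r + 2)) =
      altKernelSum (s + 2) r - altKernelSum s (r + 2) := by
  rw [altKernelSum, altKernelSum, ← (summable_altKernel _ _).tsum_sub (summable_altKernel _ _),
    tsum_congr (altKernel_sub_altKernel s r), ← tsum_alternating_even (by omega), tValue]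
  exact tsum_mul_tsum_of_summable_norm (summable_one_div_odd_pow (by omega)).norm
    (summable_norm_alternating_even (by omega))

lemma sum_tValue_mul_altZeta (K : ℕ) :
    ∑ i ∈ Finset.range K, tValue (2 * i + 3) *
        (altZeta (2 * K - 2 * i) / 2 ^ (2 * K - 2 * i)) =
      altKernelSum (2 * K) 0 - altKernelSum 0 (2 * K) := by
  have htelescope := Finset.sum_range_sub (fun i => altKernelSum (2 * i) (2 * K - 2 * i)) K
  simp only [Nat.sub_self, mul_zero, Nat.sub_zero] at htelescope
  rw [← htelescope]
  refine Finset.sum_congr rfl fun i hi => ?_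
  obtain ⟨r, hr⟩ : ∃ r, 2 * K - 2 * i = r + 2 := ⟨2 * K - 2 * i - 2, by grind⟩
  rw [hr, tValue_mul_altZeta, show 2 * K - 2 * (i + 1) = r by omega, mul_add_one]

end AltKernel

section Rows

lemma tendsto_sum_range_row (m : ℕ) :
    Tendsto (fun N : ℕ => ∑ n ∈ Finset.range N, (2 / (2 * (n : ℝ) + 1)
      - 1 / (2 * (n : ℝ) + 1 + 2 * m) - 1 / (2 * (n : ℝ) + 1 - 2 * m))) atTop
      (𝓝 (2 * oddHarmonic 1 m)) := by
  have hright := tendsto_sum_range_sub_shift (tendsto_const_div_two_mul_add 1 1) m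
  have hleft := tendsto_sum_range_sub_shift (tendsto_const_div_two_mul_add 1 (1 - 2 * m)) m
  have hreflect : ∑ i ∈ Finset.range m, 1 / (2 * (i : ℝ) + (1 - 2 * m)) = -oddHarmonic 1 m := by
    rw [oddHarmonic, ← Finset.sum_range_reflect, ← Finset.sum_neg_distrib]
    refine Finset.sum_congr rfl fun i hi => ?_
    rw [Nat.sub_sub, Nat.cast_sub (by grind), pow_one, ← one_div_neg_eq_neg_one_div]
    push_cast
    ring_nf
  rw [hreflect] at hleft
  convert hright.sub hleft using 2 with N
  · rw [← Finset.sum_sub_distrib]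
    refine Finset.sum_congr rfl fun n _ => ?_
    push_cast
    ring_nf
  · simp only [oddHarmonic, pow_one]
    ring

lemma one_div_mul_sq_sub_sq {F : Type*} [Field F] [CharZero F] {x y : F} (hx : x ≠ 0) (hy : y ≠ 0)
    (hsub : y - x ≠ 0) (hadd : y + x ≠ 0) :
    1 / (x * (y ^ 2 - x ^ 2)) = 1 / (2 * y ^ 2) * (2 / x - 1 / (x + y) - 1 / (x - y)) := by
  rw [sq_sub_sq, ← neg_sub y x, add_comm x y]
  field_simp
  ring

lemma hasSum_altKernel_row (r m : ℕ) :
    HasSum (fun n => altKernel 0 r (n, m))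
      ((-1) ^ m * oddHarmonic 1 (m + 1) / (2 * (m : ℝ) + 2) ^ (r + 2)) := by
  have hsum : Summable fun n => altKernel 0 r (n, m) :=
    (summable_altKernel 0 r).prod_symm.prod_factor m
  rw [hsum.hasSum_iff_tendsto_nat]
  convert (tendsto_sum_range_row (m + 1)).const_mul
    ((-1) ^ m / (2 * (m : ℝ) + 2) ^ r * (1 / (2 * (2 * (m : ℝ) + 2) ^ 2))) using 2 with N
  · rw [Finset.mul_sum]
    refine Finset.sum_congr rfl fun n _ => ?_
    have hfrac := one_div_mul_sq_sub_sq (x := 2 * (n : ℝ) + 1) (y := 2 * (m : ℝ) + 2)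
      (by positivity) (by positivity) (even_sub_odd_ne_zero m n) (by positivity)
    have hy : 2 * ((m + 1 : ℕ) : ℝ) = 2 * m + 2 := by push_cast; ring
    rw [hy, mul_assoc, ← hfrac, div_mul_div_comm, mul_one, altKernel, zero_add, pow_one]
    ring
  · rw [pow_add]
    field_simp

lemma hasSum_oddHarmonic_div_pow (r : ℕ) :
    HasSum (fun m : ℕ => (-1 : ℝ) ^ m * oddHarmonic 1 (m + 1) / (2 * (m : ℝ) + 2) ^ (r + 2))
      (altKernelSum 0 r) :=
  ((Equiv.prodComm ℕ ℕ).hasSum_iff.mpr (summable_altKernel 0 r).hasSum).prod_fiberwise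
    (hasSum_altKernel_row r)

end Rows

section Columns

lemma tendsto_sum_range_alternating_sub (n : ℕ) :
    Tendsto (fun M : ℕ => ∑ m ∈ Finset.range M, (-1 : ℝ) ^ m / (2 * (m : ℝ) + 2 - (2 * n + 1)))
      atTop (𝓝 ((-1) ^ n *
        (∑ i ∈ Finset.range n, (-1) ^ i / (2 * (i : ℝ) + 1) + Real.pi / 4))) := by
  have hreflect : ∑ i ∈ Finset.range n, (-1 : ℝ) ^ i / (2 * (i : ℝ) + 2 - (2 * n + 1)) =
      (-1) ^ n * ∑ i ∈ Finset.range n, (-1) ^ i / (2 * (i : ℝ) + 1) := by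
    rw [← Finset.sum_range_reflect, Finset.mul_sum]
    refine Finset.sum_congr rfl fun i hi => ?_
    obtain ⟨l, rfl⟩ : ∃ l, n = l + i + 1 := ⟨n - 1 - i, by grind⟩
    have hneg : 2 * (l : ℝ) + 2 - (2 * (l + i + 1 : ℕ) + 1) = -(2 * i + 1) := by push_cast; ring
    have hsign : (-1 : ℝ) ^ (l + i + 1) * (-1) ^ i = -(-1) ^ l := by
      rw [← pow_add, show l + i + 1 + i = l + 1 + 2 * i by ring, pow_add, pow_mul]
      simp [pow_succ]
    rw [show l + i + 1 - 1 - i = l by omega, hneg, div_neg, ← mul_div_assoc, hsign, neg_div]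
  rw [mul_add, ← hreflect]
  refine (tendsto_sum_range_shift_iff n).mp
    ((Real.tendsto_sum_pi_div_four.const_mul ((-1) ^ n)).congr fun M => ?_)
  rw [Finset.mul_sum]
  refine Finset.sum_congr rfl fun m _ => ?_
  push_cast
  ring

lemma tendsto_sum_range_alternating_add (n : ℕ) :
    Tendsto (fun M : ℕ => ∑ m ∈ Finset.range M, (-1 : ℝ) ^ m / (2 * (m : ℝ) + 2 + (2 * n + 1)))
      atTop (𝓝 ((-1) ^ n *
        (∑ i ∈ Finset.range (n + 1), (-1) ^ i / (2 * (i : ℝ) + 1) - Real.pi / 4))) := by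
  have htail : Tendsto (fun M : ℕ => ∑ m ∈ Finset.range M,
      (-1 : ℝ) ^ (m + (n + 1)) / (2 * ((m + (n + 1) : ℕ) : ℝ) + 1)) atTop
      (𝓝 (Real.pi / 4 - ∑ i ∈ Finset.range (n + 1), (-1) ^ i / (2 * (i : ℝ) + 1))) := by
    rw [tendsto_sum_range_shift_iff (f := fun i : ℕ => (-1 : ℝ) ^ i / (2 * (i : ℝ) + 1)),
      add_sub_cancel]
    exact Real.tendsto_sum_pi_div_four
  rw [← neg_sub (Real.pi / 4), mul_neg, ← neg_mul]
  refine (htail.const_mul (-(-1) ^ n)).congr fun M => ?_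
  rw [Finset.mul_sum]
  refine Finset.sum_congr rfl fun m _ => ?_
  have hsign : -(-1 : ℝ) ^ n * (-1) ^ (m + (n + 1)) = (-1) ^ m := by
    rw [neg_mul, ← pow_add, show n + (m + (n + 1)) = m + 1 + 2 * n by ring, pow_add, pow_mul]
    simp [pow_succ]
  rw [← mul_div_assoc, hsign]
  push_cast
  ring_nf

-- Reindexing shows that the two halves of the sum are the Leibniz series, one extended and one
-- truncated at its start; the corrections cancel except for the term of index `n`.
lemma tendsto_sum_range_column (n : ℕ) :
    Tendsto (fun M : ℕ => ∑ m ∈ Finset.range M, (-1 : ℝ) ^ m *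
      (1 / (2 * (m : ℝ) + 2 - (2 * n + 1)) - 1 / (2 * (m : ℝ) + 2 + (2 * n + 1)))) atTop
      (𝓝 (Real.pi / 2 * (-1) ^ n - 1 / (2 * (n : ℝ) + 1))) := by
  simp_rw [mul_sub, mul_one_div, Finset.sum_sub_distrib]
  convert (tendsto_sum_range_alternating_sub n).sub (tendsto_sum_range_alternating_add n) using 2
  have hsign : (-1 : ℝ) ^ n * ((-1) ^ n / (2 * (n : ℝ) + 1)) = 1 / (2 * (n : ℝ) + 1) := by
    rw [← mul_div_assoc, ← mul_pow]
    norm_num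
  rw [Finset.sum_range_succ, ← hsign]
  ring

lemma one_div_sq_sub_sq {F : Type*} [Field F] [CharZero F] {x y : F} (hx : x ≠ 0)
    (hsub : y - x ≠ 0) (hadd : y + x ≠ 0) :
    1 / (y ^ 2 - x ^ 2) = 1 / (2 * x) * (1 / (y - x) - 1 / (y + x)) := by
  rw [sq_sub_sq]
  field_simp
  ring

lemma hasSum_altKernel_column (s n : ℕ) :
    HasSum (fun m => altKernel s 0 (n, m))
      (Real.pi / 4 * ((-1) ^ n / (2 * (n : ℝ) + 1) ^ (s + 2)) -
        1 / 2 * (1 / (2 * (n : ℝ) + 1) ^ (s + 3))) := by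
  rw [((summable_altKernel s 0).prod_factor n).hasSum_iff_tendsto_nat]
  convert (tendsto_sum_range_column n).const_mul
    (1 / (2 * (n : ℝ) + 1) ^ (s + 1) * (1 / (2 * (2 * (n : ℝ) + 1)))) using 2 with M
  · rw [Finset.mul_sum]
    refine Finset.sum_congr rfl fun m _ => ?_
    have hfrac := one_div_sq_sub_sq (x := 2 * (n : ℝ) + 1) (y := 2 * (m : ℝ) + 2)
      (by positivity) (even_sub_odd_ne_zero m n) (by positivity)
    rw [mul_left_comm, mul_assoc, ← hfrac, altKernel, pow_zero, mul_one, one_div_mul_one_div,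
      mul_one_div]
  · field_simp
    ring

lemma altKernelSum_zero_right (s : ℕ) :
    altKernelSum s 0 = Real.pi / 4 * dirichletBeta (s + 2) - 1 / 2 * tValue (s + 3) := by
  have hbeta := (summable_norm_alternating_odd (s := s + 2) (by omega)).of_norm.hasSum
  have ht := (summable_one_div_odd_pow (s := s + 3) (by omega)).hasSum
  exact ((summable_altKernel s 0).hasSum.prod_fiberwise (hasSum_altKernel_column s)).unique
    ((hbeta.mul_left _).sub (ht.mul_left _))

end Columns

section DoubleT

lemma altDoubleTPartial_succ (a b M : ℕ) :
    altDoubleTPartial a b (M + 1) = 4 * ∑ m ∈ Finset.range M,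
      (-1 : ℝ) ^ m * (oddHarmonic a (m + 1) / (2 * (m : ℝ) + 2) ^ b) := by
  rw [altDoubleTPartial, show (2 : ℝ) ^ 2 = 4 by norm_num, ← Finset.Ico_succ_right_eq_Icc,
    Finset.sum_Ico_eq_sum_range, Nat.succ_eq_succ, Nat.succ_eq_add_one, Nat.add_sub_cancel,
    Finset.sum_range_succ']
  simp only [add_zero, Finset.Ico_self, Finset.sum_empty]
  congr 1
  refine Finset.sum_congr rfl fun m _ => ?_
  rw [Finset.sum_Ico_eq_sum_range, oddHarmonic, Finset.sum_div, Finset.mul_sum,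
    Nat.add_sub_cancel_left]
  refine Finset.sum_congr rfl fun j _ => ?_
  rw [div_div, mul_one_div, show 1 + (m + 1) = m + 2 by ring, pow_add]
  push_cast
  ring_nf

lemma oddHarmonic_div_pow_eq_average_mul (a b m : ℕ) :
    oddHarmonic a (m + 1) / (2 * (m : ℝ) + 2) ^ (b + 1) =
      (((m + 1 : ℕ) : ℝ)⁻¹ * ∑ j ∈ Finset.range (m + 1), 1 / (2 * (j : ℝ) + 1) ^ a) *
        (1 / 2 * (1 / (2 * (m : ℝ) + 2) ^ b)) := by
  rw [oddHarmonic, pow_succ]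
  push_cast
  field_simp

lemma antitone_oddHarmonic_div_pow (a b : ℕ) :
    Antitone fun m : ℕ => oddHarmonic a (m + 1) / (2 * (m : ℝ) + 2) ^ (b + 1) := by
  have hterm : Antitone fun j : ℕ => 1 / (2 * (j : ℝ) + 1) ^ a := fun i j hij => by
    dsimp only
    gcongr
  intro m n hmn
  dsimp only
  rw [oddHarmonic_div_pow_eq_average_mul, oddHarmonic_div_pow_eq_average_mul]
  refine mul_le_mul (antitone_average hterm hmn) ?_ (by positivity) (by positivity)
  gcongr

lemma tendsto_oddHarmonic_div_pow {a : ℕ} (ha : 1 ≤ a) (b : ℕ) :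
    Tendsto (fun m : ℕ => oddHarmonic a (m + 1) / (2 * (m : ℝ) + 2) ^ (b + 1)) atTop (𝓝 0) := by
  have hterm : Tendsto (fun j : ℕ => 1 / (2 * (j : ℝ) + 1) ^ a) atTop (𝓝 0) := by
    simpa [div_pow, zero_pow (by omega : a ≠ 0)] using (tendsto_const_div_two_mul_add 1 1).pow a
  refine squeeze_zero (fun m => ?_) (fun m => ?_) ((tendsto_add_atTop_iff_nat 1).mpr hterm.cesaro)
  all_goals rw [oddHarmonic_div_pow_eq_average_mul]
  · positivity
  · refine mul_le_of_le_one_right (by positivity) ?_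
    have : 1 / (2 * (m : ℝ) + 2) ^ b ≤ 1 :=
      div_le_one_of_le₀ (one_le_pow₀ (by linarith [m.cast_nonneg (α := ℝ)])) (by positivity)
    linarith

lemma tendsto_altDoubleTPartial {a b : ℕ} (ha : 1 ≤ a) (hb : 1 ≤ b) :
    Tendsto (altDoubleTPartial a b) atTop (𝓝 (altDoubleT a b)) := by
  obtain ⟨b, rfl⟩ := Nat.exists_eq_add_of_le' hb
  obtain ⟨l, hl⟩ := (antitone_oddHarmonic_div_pow a b).tendsto_alternating_series_of_tendsto_zero
    (tendsto_oddHarmonic_div_pow ha b)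
  refine tendsto_nhds_limUnder ⟨4 * l, (tendsto_add_atTop_iff_nat 1).mp ?_⟩
  simp_rw [altDoubleTPartial_succ]
  exact hl.const_mul 4

lemma sum_indices2 {M : Type*} [AddCommMonoid M] (n : ℕ) (f : ℕ → ℕ → M) :
    ∑ p ∈ indices2 (n + 2), f p.1 p.2 = ∑ i ∈ Finset.range (n + 1), f (i + 1) (n - i + 1) := by
  rw [← Finset.Nat.sum_antidiagonal_eq_sum_range_succ (fun i j => f (i + 1) (j + 1)) n]
  refine Finset.sum_nbij' (fun p => (p.1 - 1, p.2 - 1)) (fun p => (p.1 + 1, p.2 + 1)) ?_ ?_ ?_ ?_ ?_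
  all_goals
    rintro ⟨a, b⟩ h
    simp only [indices2, Finset.mem_filter, Finset.HasAntidiagonal.mem_antidiagonal] at h ⊢
    grind

lemma sum_indices2_one_div_pow {F : Type*} [Field F] {x y : F} (hx : x ≠ 0) (hy : y ≠ 0)
    (hxy : y - x ≠ 0) (n : ℕ) :
    ∑ p ∈ indices2 (n + 2), 1 / (x ^ p.1 * y ^ p.2) =
      (1 / x ^ (n + 1) - 1 / y ^ (n + 1)) / (y - x) := by
  have hgeom := geom_sum₂_mul x⁻¹ y⁻¹ (n + 1)
  rw [sum_indices2 n fun a b => 1 / (x ^ a * y ^ b), eq_div_iff hxy, one_div, one_div, ← inv_pow,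
    ← inv_pow, ← hgeom, show x⁻¹ - y⁻¹ = x⁻¹ * y⁻¹ * (y - x) by field_simp, ← mul_assoc,
    Finset.sum_mul _ _ (x⁻¹ * y⁻¹)]
  congr 1
  refine Finset.sum_congr rfl fun i _ => ?_
  rw [Nat.add_sub_cancel, one_div, mul_inv, ← inv_pow, ← inv_pow, pow_succ, pow_succ]
  ring

lemma sum_indices2_oddHarmonic_div (n m : ℕ) :
    ∑ p ∈ indices2 (n + 2), oddHarmonic p.1 (m + 1) / (2 * (m : ℝ) + 2) ^ p.2 =
      ∑ j ∈ Finset.range (m + 1),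
          1 / ((2 * (j : ℝ) + 1) ^ (n + 1) * (2 * ((m - j : ℕ) : ℝ) + 1)) -
        oddHarmonic 1 (m + 1) / (2 * (m : ℝ) + 2) ^ (n + 1) := by
  have hreflect : oddHarmonic 1 (m + 1) =
      ∑ j ∈ Finset.range (m + 1), 1 / (2 * ((m - j : ℕ) : ℝ) + 1) := by
    simp only [oddHarmonic, pow_one]
    exact (Finset.sum_range_reflect (fun j : ℕ => 1 / (2 * (j : ℝ) + 1)) (m + 1)).symm
  rw [hreflect]
  simp_rw [oddHarmonic, Finset.sum_div, div_div]
  rw [Finset.sum_comm, ← Finset.sum_sub_distrib]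
  refine Finset.sum_congr rfl fun j hj => ?_
  have hdiff : 2 * (m : ℝ) + 2 - (2 * j + 1) = 2 * ((m - j : ℕ) : ℝ) + 1 := by
    rw [Nat.cast_sub (by grind)]
    ring
  rw [sum_indices2_one_div_pow (by positivity) (by positivity) (even_sub_odd_ne_zero m j), hdiff,
    sub_div, div_div, div_div, mul_comm (2 * ((m - j : ℕ) : ℝ) + 1)]

lemma sum_altDoubleTPartial (n M : ℕ) :
    ∑ p ∈ indices2 (n + 2), altDoubleTPartial p.1 p.2 (M + 1) =
      4 * (∑ m ∈ Finset.range M, ∑ j ∈ Finset.range (m + 1),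
          (-1 : ℝ) ^ j / (2 * (j : ℝ) + 1) ^ (n + 1) *
            ((-1 : ℝ) ^ (m - j) / (2 * ((m - j : ℕ) : ℝ) + 1))
        - ∑ m ∈ Finset.range M,
          (-1 : ℝ) ^ m * oddHarmonic 1 (m + 1) / (2 * (m : ℝ) + 2) ^ (n + 1)) := by
  simp_rw [altDoubleTPartial_succ]
  rw [← Finset.mul_sum, Finset.sum_comm, ← Finset.sum_sub_distrib]
  congr 1
  refine Finset.sum_congr rfl fun m _ => ?_
  rw [← Finset.mul_sum, sum_indices2_oddHarmonic_div, mul_sub, ← mul_div_assoc, Finset.mul_sum]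
  congr 1
  refine Finset.sum_congr rfl fun j hj => ?_
  rw [div_mul_div_comm, ← pow_add, Nat.add_sub_cancel' (by grind), mul_one_div]

lemma W2_add_three (n : ℕ) :
    W2 (n + 3) = Real.pi * dirichletBeta (n + 2) - 4 * altKernelSum 0 n := by
  have hW : Tendsto (fun M => ∑ p ∈ indices2 (n + 3), altDoubleTPartial p.1 p.2 (M + 1)) atTop
      (𝓝 (W2 (n + 3))) := by
    refine tendsto_finsetSum _ fun p hp => (tendsto_add_atTop_iff_nat 1).mpr ?_
    simp only [indices2, Finset.mem_filter] at hp
    exact tendsto_altDoubleTPartial hp.2.1 hp.2.2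
  have hcauchy := tendsto_sum_range_cauchyProduct
    (summable_norm_alternating_odd (s := n + 2) (by omega)) Real.tendsto_sum_pi_div_four
  have heuler := (hasSum_oddHarmonic_div_pow n).tendsto_sum_nat
  simp_rw [sum_altDoubleTPartial (n + 1)] at hW
  rw [tendsto_nhds_unique hW ((hcauchy.sub heuler).const_mul 4), dirichletBeta]
  ring

lemma tTilde_mul_altZeta {n : ℕ} (hn : 1 < n) (s : ℕ) :
    tTilde n * altZeta s = 2 ^ (n + s) * (tValue n * (altZeta s / 2 ^ s)) := by
  rw [tTilde, if_pos hn, pow_add]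
  field_simp

lemma sum_Icc_tTilde_mul_altZeta {k : ℕ} (hk : 1 ≤ k) :
    ∑ j ∈ Finset.Icc 1 k, tTilde (2 * j + 1) * altZeta (2 * k - 2 * j) =
      tTilde (2 * k + 1) / 2 +
        ∑ j ∈ Finset.Ico 1 k, tTilde (2 * j + 1) * altZeta (2 * k - 2 * j) := by
  rw [← Finset.sum_Ico_add_eq_sum_Icc hk, Nat.sub_self, altZeta, if_pos rfl, add_comm, mul_one_div]

lemma W2_two_mul_add_one {k : ℕ} (hk : 1 ≤ k) :
    W2 (2 * k + 1) =
      1 / 2 ^ (2 * k - 1) *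
        ∑ j ∈ Finset.Icc 1 k, tTilde (2 * j + 1) * altZeta (2 * k - 2 * j) := by
  obtain ⟨K, rfl⟩ := Nat.exists_eq_add_of_le' hk
  have hproducts : ∑ j ∈ Finset.Ico 1 (K + 1), tTilde (2 * j + 1) * altZeta (2 * (K + 1) - 2 * j) =
      2 ^ (2 * K + 3) * (altKernelSum (2 * K) 0 - altKernelSum 0 (2 * K)) := by
    rw [← sum_tValue_mul_altZeta, Finset.mul_sum, Finset.sum_Ico_eq_sum_range, Nat.add_sub_cancel]
    refine Finset.sum_congr rfl fun i hi => ?_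
    have hi : i < K := Finset.mem_range.mp hi
    rw [tTilde_mul_altZeta (by omega), show 2 * (1 + i) + 1 = 2 * i + 3 by ring,
      show 2 * (K + 1) - 2 * (1 + i) = 2 * K - 2 * i by omega,
      show 2 * i + 3 + (2 * K - 2 * i) = 2 * K + 3 by omega]
  rw [sum_Icc_tTilde_mul_altZeta hk, hproducts, altKernelSum_zero_right, tTilde,
    if_pos (by omega), show 2 * (K + 1) + 1 = 2 * K + 3 by ring, W2_add_three,
    show 2 * (K + 1) - 1 = 2 * K + 1 by omega, show 2 * K + 3 = (2 * K + 1) + 2 by ring,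
    pow_add _ (2 * K + 1)]
  field_simp
  ring

end DoubleT

section Zeta

lemma ofReal_tsum_one_div_add_one_pow {n : ℕ} (hn : 1 < n) :
    ((∑' m : ℕ, 1 / ((m : ℝ) + 1) ^ n : ℝ) : ℂ) = riemannZeta n := by
  have hzeta := zeta_eq_tsum_one_div_nat_add_one_cpow (s := n) (by simpa using hn)
  simp_rw [Complex.cpow_natCast] at hzeta
  rw [hzeta, Complex.ofReal_tsum]
  push_cast
  rfl

lemma hasSum_one_div_even_pow {n : ℕ} (hn : 1 < n) :
    HasSum (fun m : ℕ => 1 / (2 * (m : ℝ) + 2) ^ n)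
      ((∑' m : ℕ, 1 / ((m : ℝ) + 1) ^ n) / 2 ^ n) := by
  convert (summable_one_div_even_pow hn).hasSum using 1
  rw [← tsum_div_const]
  refine tsum_congr fun m => ?_
  rw [show 2 * (m : ℝ) + 2 = (m + 1) * 2 by ring, mul_pow, div_div]

lemma tValue_eq {n : ℕ} (hn : 1 < n) :
    tValue n = (1 - 1 / 2 ^ n) * ∑' m : ℕ, 1 / ((m : ℝ) + 1) ^ n := by
  have hsplit : HasSum (fun m : ℕ => 1 / ((m : ℝ) + 1) ^ n)
      (tValue n + (∑' m : ℕ, 1 / ((m : ℝ) + 1) ^ n) / 2 ^ n) := by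
    refine HasSum.even_add_odd ?_ ?_
    · simpa [tValue] using (summable_one_div_odd_pow hn).hasSum
    · simpa [add_assoc, one_add_one_eq_two] using hasSum_one_div_even_pow hn
  rw [sub_mul, one_mul, one_div_mul_eq_div, eq_sub_iff_add_eq, hsplit.tsum_eq.symm]

lemma altZeta_eq {n : ℕ} (hn : 1 < n) :
    altZeta n = (1 - 2 / 2 ^ n) * ∑' m : ℕ, 1 / ((m : ℝ) + 1) ^ n := by
  have hsplit : HasSum (fun m : ℕ => (-1 : ℝ) ^ m / ((m : ℝ) + 1) ^ n)
      (tValue n + -((∑' m : ℕ, 1 / ((m : ℝ) + 1) ^ n) / 2 ^ n)) := by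
    refine HasSum.even_add_odd ?_ ?_
    · simpa [tValue] using (summable_one_div_odd_pow hn).hasSum
    · simpa [pow_succ, add_assoc, one_add_one_eq_two, neg_div] using
        (hasSum_one_div_even_pow hn).neg
  rw [(hasSum_altZeta hn).unique hsplit, tValue_eq hn]
  ring

lemma ofReal_tTilde {n : ℕ} (hn : 1 < n) :
    ((tTilde n : ℝ) : ℂ) = (2 ^ n - 1) * riemannZeta n := by
  rw [tTilde, if_pos hn, tValue_eq hn, ← ofReal_tsum_one_div_add_one_pow hn]
  push_cast
  field_simp

lemma ofReal_altZeta {n : ℕ} (hn : 1 < n) :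
    ((altZeta n : ℝ) : ℂ) = (1 - 2 / 2 ^ n) * riemannZeta n := by
  rw [altZeta_eq hn, ← ofReal_tsum_one_div_add_one_pow hn]
  push_cast
  rfl

end Zeta

theorem theorem3p4 (k : ℕ) (hk : 1 ≤ k) :
    -- every series in the weighted sum converges
    (∀ a b : ℕ, 1 ≤ a → 1 ≤ b → a + b = 2 * k + 1 →
      Tendsto (altDoubleTPartial a b) atTop (𝓝 (altDoubleT a b))) ∧
    -- the evaluation
    W2 (2 * k + 1) =
      1 / 2 ^ (2 * k - 1) *
        ∑ j ∈ Finset.Icc 1 k, tTilde (2 * j + 1) * altZeta (2 * k - 2 * j) ∧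
    -- the normalised t-values in terms of zeta values
    (∀ n : ℕ, 1 < n → ((tTilde n : ℝ) : ℂ) = (2 ^ n - 1) * riemannZeta (n : ℂ)) ∧
    -- the resulting expression in zeta values
    ((W2 (2 * k + 1) : ℝ) : ℂ) =
      1 / 2 ^ (2 * k - 1) *
        ((2 ^ (2 * k + 1) - 1) * riemannZeta ((2 * k + 1 : ℕ) : ℂ) / 2 +
          ∑ j ∈ Finset.Ico 1 k,
            (2 ^ (2 * j + 1) - 1) * riemannZeta ((2 * j + 1 : ℕ) : ℂ) *
              ((1 - 2 / 2 ^ (2 * k - 2 * j)) *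
                riemannZeta ((2 * k - 2 * j : ℕ) : ℂ))) := by
  refine ⟨fun a b ha hb _ => tendsto_altDoubleTPartial ha hb, W2_two_mul_add_one hk,
    fun n hn => ofReal_tTilde hn, ?_⟩
  have hterm : ∀ j ∈ Finset.Ico 1 k,
      ((tTilde (2 * j + 1) * altZeta (2 * k - 2 * j) : ℝ) : ℂ) =
        (2 ^ (2 * j + 1) - 1) * riemannZeta ((2 * j + 1 : ℕ) : ℂ) *
          ((1 - 2 / 2 ^ (2 * k - 2 * j)) * riemannZeta ((2 * k - 2 * j : ℕ) : ℂ)) := by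
    intro j hj
    rw [Finset.mem_Ico] at hj
    rw [Complex.ofReal_mul, ofReal_tTilde (by omega), ofReal_altZeta (by omega)]
  rw [W2_two_mul_add_one hk, sum_Icc_tTilde_mul_altZeta hk, Complex.ofReal_mul, Complex.ofReal_add,
    Complex.ofReal_sum, Finset.sum_congr rfl hterm, Complex.ofReal_div (tTilde _),
    ofReal_tTilde (by omega)]
  norm_num
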